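/- Let $\mathcal C$ be a (not necessarily unital) C*-algebra. For subspaces $X,Y$ of a normed space and $\gamma>0$ write $X\subseteq_\gamma Y$ if for every $x\in X$ with $\|x\|\le 1$ there is $y\in Y$ with $\|x-y\|\le\gamma$; the Christensen distance is $$d_0(X,Y)=\inf\{\gamma>0 : X\subseteq_\gamma Y \text{ and } Y\subseteq_\gamma X\}.$$ Let $\pi_{\mathcal C}:\mathcal C\to B(\mathcal H_{\mathcal C})$ be the universal representation of $\mathcal C$, i.e. the direct sum of the GNS representations of all states of $\mathcal C$. The enveloping von Neumann algebra $\mathcal C^{**}$ of $\mathcal C$ is the Banach space bidual of $\mathcal C$, identified with the bicommutant $\pi_{\mathcal C}(\mathcal C)''$. For a C*-subalgebra $\mathcal A\subseteq\mathcal C$ with inclusion map $i$, the enveloping von Neumann algebra $\mathcal A^{**}$ sits inside $\mathcal C^{**}$: in the bidual of $\mathcal C$ as the range of $i^{**}$, and in $\pi_{\mathcal C}(\mathcal C)''$ as the closure $\overline{\pi_{\mathcal C}(\mathcal A)}^{\,\mathrm{WOT}}$ in the weak operator topology. **Theorem.** For any two C*-subalgebras $\mathcal A,\mathcal B$ of $\mathcal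 C$, $$d_0(\mathcal A,\mathcal B)=d_0(\mathcal A^{**},\mathcal B^{**}),$$ where the right-hand side is computed inside $\mathcal C^{**}$. The equality holds in both pictures of $\mathcal C^{**}$, that is, $$d_0(\mathcal A,\mathcal B)=d_0\big(i_{\mathcal A}^{**}(\mathcal A^{**}),\,i_{\mathcal B}^{**}(\mathcal B^{**})\big)=d_0\Big(\overline{\pi_{\mathcal C}(\mathcal A)}^{\,\mathrm{WOT}},\,\overline{\pi_{\mathcal C}(\mathcal B)}^{\,\mathrm{WOT}}\Big).$$ -/

import Mathlib

open scoped ComplexOrder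

noncomputable section

namespace EnvelopingDistance

universe u

section Distance

variable {E : Type*} [SeminormedAddCommGroup E]

/-- The near inclusion `S ⊆_γ T`: every element of the closed unit ball of `S` is within
distance `γ` of some element of `T` (which need not lie in the unit ball). -/
def NearIncl (γ : ℝ) (S T : Set E) : Prop :=
  ∀ x ∈ S, ‖x‖ ≤ 1 → ∃ y ∈ T, ‖x - y‖ ≤ γ

/-- The Christensen distance between two subspaces (given by their sets of elements) of a
normed space. For subspaces the set of admissible `γ` contains `1` and is bounded below. -/
def christensenDist (S T : Set E) : ℝ :=
  sInf {γ : ℝ | 0 < γ ∧ NearIncl γ S T ∧ NearIncl γ T S}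

end Distance

section BanachBidual

variable {C : Type u} [NonUnitalCStarAlgebra C]

/-- The Banach space bidual `C**`, with its operator norm. -/
abbrev Bidual (C : Type u) [NonUnitalCStarAlgebra C] : Type u :=
  StrongDual ℂ (StrongDual ℂ C)

/-- The restriction map `i* : C* → A*`, where `i : A → C` is the inclusion. -/
def restrictDual (A : NonUnitalStarSubalgebra ℂ C) :
    StrongDual ℂ C →L[ℂ] StrongDual ℂ A.toSubmodule :=
  ContinuousLinearMap.precomp ℂ A.toSubmodule.subtypeL

/-- The second adjoint `i** : A** → C**` of the inclusion `i : A → C`. -/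
def bidualInclusion (A : NonUnitalStarSubalgebra ℂ C) :
    StrongDual ℂ (StrongDual ℂ A.toSubmodule) →L[ℂ] Bidual C :=
  ContinuousLinearMap.precomp ℂ (restrictDual A)

/-- `A**` as a subspace of `C**`: the range of `i**`. -/
def bidualOf (A : NonUnitalStarSubalgebra ℂ C) : Set (Bidual C) :=
  Set.range (bidualInclusion A)

end BanachBidual

section DirectSum

variable {C : Type*} [NonUnitalCStarAlgebra C] {ι : Type*} {H : ι → Type*}
  [∀ i, NormedAddCommGroup (H i)] [∀ i, InnerProductSpace ℂ (H i)] [∀ i, CompleteSpace (H i)]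

lemma norm_rep_apply_le {K : Type*} [NormedAddCommGroup K] [InnerProductSpace ℂ K]
    [CompleteSpace K] (π : C →⋆ₙₐ[ℂ] (K →L[ℂ] K)) (a : C) (x : K) :
    ‖π a x‖ ≤ ‖(‖a‖ : ℂ) • x‖ := by
  rw [norm_smul, Complex.norm_real, norm_norm]
  exact ContinuousLinearMap.le_of_opNorm_le _ (NonUnitalStarAlgHom.norm_apply_le π a) x

lemma memℓp_rep (π : ∀ i, C →⋆ₙₐ[ℂ] (H i →L[ℂ] H i)) (a : C) (x : lp H 2) :
    Memℓp (fun i => π i a (x i)) 2 := by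
  have h2 : 0 < (2 : ENNReal).toReal := by norm_num
  have hx : Memℓp (fun i => (‖a‖ : ℂ) • x i) 2 := (lp.memℓp x).const_smul _
  refine memℓp_gen (Summable.of_nonneg_of_le (fun i => by positivity) (fun i => ?_)
    (hx.summable h2))
  exact Real.rpow_le_rpow (norm_nonneg _) (norm_rep_apply_le (π i) a (x i)) h2.le

/-- The operator `⨁ᵢ πᵢ(a)` on the Hilbert sum `⨁ᵢ Hᵢ`. -/
def directSumOp (π : ∀ i, C →⋆ₙₐ[ℂ] (H i →L[ℂ] H i)) (a : C) : lp H 2 →L[ℂ] lp H 2 :=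
  LinearMap.mkContinuous
    { toFun := fun x => ⟨fun i => π i a (x i), memℓp_rep π a x⟩
      map_add' := fun x y => by
        ext i
        exact map_add (π i a) (x i) (y i)
      map_smul' := fun c x => by
        ext i
        exact map_smul (π i a) c (x i) }
    ‖a‖ (fun x => by
      have h : ‖a‖ * ‖x‖ = ‖(‖a‖ : ℂ) • x‖ := by
        rw [norm_smul, Complex.norm_real, norm_norm]
      rw [h]
      exact lp.norm_mono (by norm_num) (fun i => norm_rep_apply_le (π i) a (x i)))

lemma directSumOp_apply (π : ∀ i, C →⋆ₙₐ[ℂ] (H i →L[ℂ] H i)) (a : C) (x : lp H 2) (i : ι) :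
    (directSumOp π a x) i = π i a (x i) := rfl

/-- The direct sum `⨁ᵢ πᵢ` of a family of representations on Hilbert spaces. -/
def directSumRep (π : ∀ i, C →⋆ₙₐ[ℂ] (H i →L[ℂ] H i)) :
    C →⋆ₙₐ[ℂ] (lp H 2 →L[ℂ] lp H 2) where
  toFun := directSumOp π
  map_smul' c a := by
    ext x i
    simp [directSumOp_apply]
  map_zero' := by
    ext x i
    simp [directSumOp_apply]
  map_add' a b := by
    ext x i
    simp [directSumOp_apply]
  map_mul' a b := by
    ext x i
    simp [directSumOp_apply]
  map_star' a := by
    rw [ContinuousLinearMap.star_eq_adjoint, ContinuousLinearMap.eq_adjoint_iff]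
    intro x y
    rw [lp.inner_eq_tsum, lp.inner_eq_tsum]
    refine tsum_congr fun i => ?_
    rw [directSumOp_apply, directSumOp_apply, map_star, ContinuousLinearMap.star_eq_adjoint,
      ContinuousLinearMap.adjoint_inner_left]

end DirectSum

section UniversalRepresentation

variable (C : Type u) [NonUnitalCStarAlgebra C] [PartialOrder C] [StarOrderedRing C]

/-- The state space of `C`: positive linear functionals of norm one. -/
def StateSpace : Type u :=
  {φ : C →ₚ[ℂ] ℂ // ‖(⟨φ.toLinearMap, map_continuous φ⟩ : StrongDual ℂ C)‖ = 1}

/-- The Hilbert space `H_C = ⨁_φ H_φ` of the universal representation: the Hilbert sum of the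
GNS spaces of all states. -/
abbrev UniversalSpace : Type u :=
  lp (fun φ : StateSpace C => φ.1.GNS) 2

/-- The universal representation `π_C : C → B(H_C)`, the direct sum of the GNS representations of
all states of `C`. -/
def universalRep : C →⋆ₙₐ[ℂ] (UniversalSpace C →L[ℂ] UniversalSpace C) :=
  directSumRep fun φ : StateSpace C => φ.1.gnsNonUnitalStarAlgHom

/-- The enveloping von Neumann algebra of `C`, realised as the bicommutant `π_C(C)''`. -/
def envelopingVNA : VonNeumannAlgebra (UniversalSpace C) where
  toStarSubalgebra := StarSubalgebra.centralizer ℂ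
    (StarSubalgebra.centralizer ℂ (Set.range (universalRep C)) :
      Set (UniversalSpace C →L[ℂ] UniversalSpace C))
  centralizer_centralizer' := by simp

end UniversalRepresentation

section WOT

variable {H : Type*} [NormedAddCommGroup H] [InnerProductSpace ℂ H]

/-- The closure of a set of bounded operators in the weak operator topology. -/
def wotClosure (S : Set (H →L[ℂ] H)) : Set (H →L[ℂ] H) :=
  {T | ContinuousLinearMapWOT.ofCLM T ∈
    closure ((fun R : H →L[ℂ] H => ContinuousLinearMapWOT.ofCLM R) '' S)}

end WOT

variable {C : Type u} [NonUnitalCStarAlgebra C] [PartialOrder C] [StarOrderedRing C]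

/-- The weak operator closure of `π_C(A)` lies inside `π_C(C)''`. -/
lemma wotClosure_subset_envelopingVNA (A : NonUnitalStarSubalgebra ℂ C) :
    wotClosure (universalRep C '' (A : Set C)) ⊆ (envelopingVNA C : Set _) := by
  intro T hT
  change T ∈ Set.centralizer _
  rw [Set.mem_centralizer_iff]
  intro g hg
  replace hg : g ∈ StarSubalgebra.centralizer ℂ (Set.range (universalRep C)) :=
    hg.elim id fun h => by simpa using star_mem (Set.mem_star.1 h)
  rw [StarSubalgebra.mem_centralizer_iff] at hg
  have hcl : IsClosed {R : UniversalSpace C →WOT[ℂ] UniversalSpace C |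
      (ContinuousLinearMapWOT.ofCLM g).comp R = R.comp (ContinuousLinearMapWOT.ofCLM g)} :=
    isClosed_eq (ContinuousLinearMapWOT.continuous_postcomp _)
      (ContinuousLinearMapWOT.continuous_precomp _)
  refine congrArg ContinuousLinearMapWOT.toCLM (closure_minimal ?_ hcl hT)
  rintro _ ⟨_, ⟨a, ha, rfl⟩, rfl⟩
  exact congrArg ContinuousLinearMapWOT.ofCLM (hg _ ⟨a, rfl⟩).1.symm

/-- The enveloping von Neumann algebra `A**` of a C*-subalgebra `A` of `C`, sitting inside
`C** = π_C(C)''` as the closure of `π_C(A)` in the weak operator topology. -/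
def envelopingOf (A : NonUnitalStarSubalgebra ℂ C) : Set (envelopingVNA C) :=
  {T | (T : UniversalSpace C →L[ℂ] UniversalSpace C) ∈ wotClosure (universalRep C '' (A : Set C))}

end EnvelopingDistance

end

open scoped ComplexOrder InnerProductSpace

namespace EnvelopingDistance

/-! ### Comparison and invariance of the Christensen distance -/

section Distance

/-! The first equality is pure Banach space duality. `A**` is the double annihilator of `A`, so a
near inclusion of `A` in `B` bounds the elements of the unit ball of `A**` by `γ` on the annihilator
of `B`, and Hahn-Banach turns this bound into a correction of norm at most `γ`
(`nearIncl_bidualOf`). Conversely, a functional norming `x` modulo `B` also kills `B**`, so the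
distance from `x` to `B` does not drop in the bidual.

For the second equality, `π_C` extends to a map `C** → B(H_C)` through `⟪η, T ξ⟫ = F (ω_{η,ξ})`.
Every functional on `C` is a vector functional of `π_C` with control of norms
(`exists_universalRep_inner`), so the extension is isometric and carries `A**` onto the weak
operator closure of `π_C(A)` (`RepresentsDual.image_bidualOf`). Behind this lies
`exists_dominating_functional`: the functionals dominated by quasi-states form a convex weak*
compact set that norms `C`, hence contain the dual unit ball; GNS and Riesz then supply the vectors.
-/

lemma christensenDist_eq_of_nearIncl {E F : Type*} [SeminormedAddCommGroup E]
    [SeminormedAddCommGroup F] {S T : Set E} {S' T' : Set F}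
    (hS : ∀ γ, 0 < γ → NearIncl γ S T → NearIncl γ S' T')
    (hT : ∀ γ, 0 < γ → NearIncl γ T S → NearIncl γ T' S')
    (hS' : ∀ γ δ, 0 < γ → γ < δ → NearIncl γ S' T' → NearIncl δ S T)
    (hT' : ∀ γ δ, 0 < γ → γ < δ → NearIncl γ T' S' → NearIncl δ T S) :
    christensenDist S T = christensenDist S' T' := by
  unfold christensenDist
  set P : Set ℝ := {γ : ℝ | 0 < γ ∧ NearIncl γ S T ∧ NearIncl γ T S}
  set Q : Set ℝ := {γ : ℝ | 0 < γ ∧ NearIncl γ S' T' ∧ NearIncl γ T' S'}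
  have hPQ : P ⊆ Q := fun γ hγ => ⟨hγ.1, hS γ hγ.1 hγ.2.1, hT γ hγ.1 hγ.2.2⟩
  have hQP : ∀ γ ∈ Q, ∀ δ, γ < δ → δ ∈ P := fun γ hγ δ hδ =>
    ⟨hγ.1.trans hδ, hS' γ δ hγ.1 hδ hγ.2.1, hT' γ δ hγ.1 hδ hγ.2.2⟩
  have hP : BddBelow P := ⟨0, fun _ hγ => hγ.1.le⟩
  have hQ : BddBelow Q := ⟨0, fun _ hγ => hγ.1.le⟩
  rcases P.eq_empty_or_nonempty with h | h
  -- The two sets are empty together, so both infima take the same default value.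
  · rw [h, Q.eq_empty_of_forall_notMem fun γ hγ =>
      Set.notMem_empty (γ + 1) (h ▸ hQP γ hγ _ (lt_add_one γ))]
  · exact le_antisymm
      (le_csInf (h.mono hPQ) fun γ hγ => le_of_forall_gt_imp_ge_of_dense fun δ hδ =>
        csInf_le hP (hQP γ hγ δ hδ))
      (csInf_le_csInf hQ h hPQ)

lemma nearIncl_image_iff {E F : Type*} [SeminormedAddCommGroup E] [SeminormedAddCommGroup F]
    (f : E →+ F) (hf : ∀ x, ‖f x‖ = ‖x‖) (γ : ℝ) (S T : Set E) :
    NearIncl γ (f '' S) (f '' T) ↔ NearIncl γ S T := by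
  simp only [NearIncl, Set.forall_mem_image, Set.exists_mem_image, ← map_sub, hf]

lemma christensenDist_image {E F : Type*} [SeminormedAddCommGroup E] [SeminormedAddCommGroup F]
    (f : E →+ F) (hf : ∀ x, ‖f x‖ = ‖x‖) (S T : Set E) :
    christensenDist (f '' S) (f '' T) = christensenDist S T := by
  simp only [christensenDist, nearIncl_image_iff f hf]

end Distance

/-! ### Double annihilators and the Banach space bidual -/

section BanachBidual

universe u

variable {C : Type u} [NonUnitalCStarAlgebra C]

lemma exists_restrictDual_eq (A : NonUnitalStarSubalgebra ℂ C)
    (ψ : StrongDual ℂ A.toSubmodule) : ∃ φ, restrictDual A φ = ψ ∧ ‖φ‖ = ‖ψ‖ := by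
  obtain ⟨φ, h, hφ⟩ := exists_extension_norm_eq A.toSubmodule ψ
  exact ⟨φ, ContinuousLinearMap.ext h, hφ⟩

/-- `A**` is the double annihilator of `A`. -/
lemma mem_bidualOf_iff (A : NonUnitalStarSubalgebra ℂ C) (F : Bidual C) :
    F ∈ bidualOf A ↔ ∀ φ, restrictDual A φ = 0 → F φ = 0 := by
  constructor
  · rintro ⟨G, rfl⟩ φ hφ
    change G (restrictDual A φ) = 0
    rw [hφ, map_zero]
  · intro h
    -- The norm-preserving extension `e` need not be linear, but `F ∘ e` is, since `F` ignores
    -- functionals vanishing on `A`.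
    choose e he hn using exists_restrictDual_eq A
    have key : ∀ φ ψ, restrictDual A φ = restrictDual A ψ → F φ = F ψ := fun φ ψ hφψ =>
      sub_eq_zero.1 (by rw [← map_sub]; exact h _ (by rw [map_sub, hφψ, sub_self]))
    refine ⟨LinearMap.mkContinuous
      { toFun := fun ψ => F (e ψ)
        map_add' := fun ψ χ => by
          rw [← map_add]
          exact key _ _ (by simp only [map_add, he])
        map_smul' := fun c ψ => by
          rw [RingHom.id_apply, ← map_smul]
          exact key _ _ (by simp only [map_smul, he]) } ‖F‖ fun ψ => ?_, ?_⟩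
    · exact (F.le_opNorm _).trans_eq (by rw [hn])
    · ext φ
      exact key _ _ (he _)

lemma norm_apply_le_of_mem_bidualOf {A : NonUnitalStarSubalgebra ℂ C} {F : Bidual C}
    (hF : F ∈ bidualOf A) (φ : StrongDual ℂ C) : ‖F φ‖ ≤ ‖F‖ * ‖restrictDual A φ‖ := by
  obtain ⟨ψ, hψ, hn⟩ := exists_restrictDual_eq A (restrictDual A φ)
  have h : F φ = F ψ := sub_eq_zero.1 (by
    rw [← map_sub]
    exact (mem_bidualOf_iff A F).1 hF _ (by rw [map_sub, hψ, sub_self]))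
  rw [h, ← hn]
  exact F.le_opNorm ψ

/-- On the annihilator `N` of `B`, `F` has norm at most `γ`. A Hahn-Banach extension `G` of `F|_N`
keeps this norm, and `F - G` kills `N`. -/
lemma nearIncl_bidualOf {A B : NonUnitalStarSubalgebra ℂ C} {γ : ℝ} (hγ : 0 < γ)
    (h : NearIncl γ (A : Set C) (B : Set C)) : NearIncl γ (bidualOf A) (bidualOf B) := by
  intro F hF hF1
  let N : Submodule ℂ (StrongDual ℂ C) := LinearMap.ker (restrictDual B).toLinearMap
  have hres : ∀ φ ∈ N, ‖restrictDual A φ‖ ≤ γ * ‖φ‖ := by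
    intro φ hφ
    refine ContinuousLinearMap.opNorm_le_of_unit_norm (by positivity) fun a ha => ?_
    obtain ⟨b, hb, hab⟩ := h a a.2 ha.le
    have hb0 : φ b = 0 := DFunLike.congr_fun hφ (⟨b, hb⟩ : B.toSubmodule)
    calc ‖φ a‖ = ‖φ (a - b)‖ := by rw [map_sub, hb0, sub_zero]
      _ ≤ ‖φ‖ * ‖(a : C) - b‖ := φ.le_opNorm _
      _ ≤ γ * ‖φ‖ := by rw [mul_comm γ]; gcongr
  obtain ⟨G, hG, hGn⟩ := exists_extension_norm_eq N (F.comp N.subtypeL)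
  refine ⟨F - G, (mem_bidualOf_iff B _).2 fun φ hφ => ?_, ?_⟩
  · have := hG ⟨φ, hφ⟩
    simp_all
  · rw [show F - (F - G) = G from sub_sub_cancel F G, hGn]
    refine ContinuousLinearMap.opNorm_le_bound _ hγ.le fun φ => ?_
    calc ‖F φ‖ ≤ ‖F‖ * ‖restrictDual A φ‖ := norm_apply_le_of_mem_bidualOf hF _
      _ ≤ 1 * (γ * ‖(φ : StrongDual ℂ C)‖) := by
        gcongr
        exact hres φ φ.2
      _ = γ * ‖φ‖ := one_mul _

/-- The quotient norm of `x` modulo `B` is at most `γ`; since it need not be attained, an actual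
element of `B` costs the passage to `δ`. -/
lemma nearIncl_of_nearIncl_bidualOf {A B : NonUnitalStarSubalgebra ℂ C} {γ δ : ℝ} (hδ : γ < δ)
    (h : NearIncl γ (bidualOf A) (bidualOf B)) : NearIncl δ (A : Set C) (B : Set C) := by
  intro x hx hx1
  obtain ⟨G, hG, hxG⟩ := h (NormedSpace.inclusionInDoubleDual ℂ C x)
    ((mem_bidualOf_iff A _).2 fun φ hφ => DFunLike.congr_fun hφ (⟨x, hx⟩ : A.toSubmodule))
    ((NormedSpace.double_dual_bound ℂ C x).trans hx1)
  obtain ⟨g, hg1, hg⟩ := exists_dual_vector'' ℂ (B.toSubmodule.mkQ x)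
  let φ : StrongDual ℂ C := LinearMap.mkContinuous (g.toLinearMap ∘ₗ B.toSubmodule.mkQ) 1 fun c =>
    (g.le_opNorm _).trans (by
      gcongr
      exact Submodule.Quotient.norm_mk_le _ c)
  have hφ1 : ‖φ‖ ≤ 1 := LinearMap.mkContinuous_norm_le _ zero_le_one _
  have hφB : restrictDual B φ = 0 := by
    ext b
    change g (B.toSubmodule.mkQ b) = 0
    rw [show B.toSubmodule.mkQ b = 0 from (Submodule.Quotient.mk_eq_zero _).2 b.2, map_zero]
  have hGφ : G φ = 0 := (mem_bidualOf_iff B G).1 hG φ hφB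
  have hle : ‖B.toSubmodule.mkQ x‖ ≤ γ := by
    have h1 := (NormedSpace.inclusionInDoubleDual ℂ C x - G).le_opNorm φ
    have h2 : (NormedSpace.inclusionInDoubleDual ℂ C x - G) φ = (‖B.toSubmodule.mkQ x‖ : ℂ) := by
      rw [sub_apply, hGφ, sub_zero]
      exact hg
    rw [h2, Complex.norm_real, norm_norm] at h1
    exact h1.trans ((mul_le_of_le_one_right (norm_nonneg _) hφ1).trans hxG)
  obtain ⟨m, hm, hmn⟩ := Submodule.Quotient.norm_mk_lt (B.toSubmodule.mkQ x) (sub_pos.2 hδ)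
  refine ⟨x - m, (Submodule.Quotient.eq B.toSubmodule).1 hm.symm, ?_⟩
  rw [sub_sub_cancel]
  linarith

theorem christensenDist_bidualOf (A B : NonUnitalStarSubalgebra ℂ C) :
    christensenDist (A : Set C) (B : Set C) = christensenDist (bidualOf A) (bidualOf B) :=
  christensenDist_eq_of_nearIncl (fun _ => nearIncl_bidualOf) (fun _ => nearIncl_bidualOf)
    (fun _ _ _ => nearIncl_of_nearIncl_bidualOf) (fun _ _ _ => nearIncl_of_nearIncl_bidualOf)

end BanachBidual

/-! ### Domination of functionals by positive functionals -/

section Positivity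

/-- Hahn-Banach separation in the weak* topology: the separating functional is an evaluation. -/
lemma exists_re_apply_lt_of_notMem_weakDual {𝕜 E : Type*} [RCLike 𝕜] [SeminormedAddCommGroup E]
    [NormedSpace 𝕜 E] {K : Set (WeakDual 𝕜 E)} (hK : Convex ℝ K) (hKc : IsClosed K)
    {φ : WeakDual 𝕜 E} (hφ : φ ∉ K) :
    ∃ x : E, ∃ u : ℝ, (∀ χ ∈ K, RCLike.re (χ x) < u) ∧ u < RCLike.re (φ x) := by
  have : LocallyConvexSpace ℝ (WeakDual 𝕜 E) :=
    WeakBilin.locallyConvexSpace (𝕜 := 𝕜) (B := topDualPairing 𝕜 E)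
  have hsep := RCLike.geometric_hahn_banach_closed_point (𝕜 := 𝕜) (E := WeakDual 𝕜 E)
    (s := K) (x := φ)
  obtain ⟨f, u, hfu, huf⟩ := hsep hK hKc hφ
  obtain ⟨x, hx⟩ := LinearMap.dualEmbedding_surjective (topDualPairing 𝕜 E) f
  have hfx : ∀ χ : WeakDual 𝕜 E, f χ = χ x := fun χ => by rw [← hx]; rfl
  simp only [hfx] at hfu huf
  exact ⟨x, u, hfu, huf⟩

lemma im_apply_eq_zero_of_isSelfAdjoint {A : Type*} [CStarAlgebra A] {f : StrongDual ℂ A}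
    (hf : ‖f‖ ≤ 1) (hf1 : f 1 = 1) {a : A} (ha : IsSelfAdjoint a) : (f a).im = 0 := by
  by_contra h
  have key : ∀ t : ℝ, ((f a).im + t) ^ 2 ≤ ‖a‖ ^ 2 + t ^ 2 := by
    intro t
    have h1 : ‖a + (t * Complex.I : ℂ) • (1 : A)‖ ^ 2 ≤ ‖a‖ ^ 2 + t ^ 2 := by
      have h2 : star (a + (t * Complex.I : ℂ) • (1 : A)) * (a + (t * Complex.I : ℂ) • (1 : A)) =
          a * a + ((t ^ 2 : ℝ) : ℂ) • (1 : A) := by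
        have h3 : (t * Complex.I : ℂ) * (t * Complex.I) = -((t ^ 2 : ℝ) : ℂ) := by
          rw [mul_mul_mul_comm, Complex.I_mul_I]
          push_cast
          ring
        simp only [star_add, star_smul, ha.star_eq, star_one, add_mul, mul_add, smul_mul_assoc, smul_add,
          mul_smul_comm, one_mul, mul_one, smul_smul, Complex.star_def, map_mul, Complex.conj_I,
          Complex.conj_ofReal, mul_neg, neg_mul, neg_smul, smul_neg, h3, neg_neg]
        abel
      have h3 : ‖(1 : A)‖ ≤ 1 := by
        rcases subsingleton_or_nontrivial A with _ | _
        · simp [Subsingleton.elim (1 : A) 0]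
        · exact CStarRing.norm_one.le
      rw [sq, ← CStarRing.norm_star_mul_self, h2]
      refine (norm_add_le _ _).trans (add_le_add ((norm_mul_le _ _).trans (sq _).ge) ?_)
      rw [norm_smul, Complex.norm_real, Real.norm_of_nonneg (sq_nonneg t)]
      exact mul_le_of_le_one_right (sq_nonneg t) h3
    have h4 : f (a + (t * Complex.I : ℂ) • (1 : A)) = f a + t * Complex.I := by
      rw [map_add, map_smul, hf1, smul_eq_mul, mul_one]
    calc ((f a).im + t) ^ 2 = |(f a + t * Complex.I).im| ^ 2 := by simp
      _ ≤ ‖f a + t * Complex.I‖ ^ 2 := by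
        gcongr
        exact Complex.abs_im_le_norm _
      _ ≤ ‖a + (t * Complex.I : ℂ) • (1 : A)‖ ^ 2 := by
        rw [← h4]
        gcongr
        exact (f.le_opNorm _).trans (mul_le_of_le_one_left (norm_nonneg _) hf)
      _ ≤ _ := h1
  -- This `t` makes the cross term of the square `2‖a‖²`, which exceeds the available `‖a‖²`.
  have h5 := key (‖a‖ ^ 2 / (f a).im)
  have h6 : (f a).im * (‖a‖ ^ 2 / (f a).im) = ‖a‖ ^ 2 := mul_div_cancel₀ _ h
  have h7 : 0 < (f a).im ^ 2 := by positivity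
  nlinarith [sq_nonneg ‖a‖]

/-- Since `‖‖a‖·1 - a‖ ≤ ‖a‖`, contractivity gives `‖a‖ - Re f(a) ≤ ‖a‖`. -/
lemma apply_nonneg_of_norm_le_one {A : Type*} [CStarAlgebra A] [PartialOrder A]
    [StarOrderedRing A] {f : StrongDual ℂ A} (hf : ‖f‖ ≤ 1) (hf1 : f 1 = 1) {a : A}
    (ha : 0 ≤ a) : 0 ≤ f a := by
  have him := im_apply_eq_zero_of_isSelfAdjoint hf hf1 (IsSelfAdjoint.of_nonneg ha)
  refine Complex.nonneg_iff.2 ⟨?_, him.symm⟩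
  have h1 : a ≤ algebraMap ℝ A ‖a‖ :=
    (CStarAlgebra.norm_le_iff_le_algebraMap a (norm_nonneg a)).1 le_rfl
  have h2 : ‖algebraMap ℝ A ‖a‖ - a‖ ≤ ‖a‖ :=
    (CStarAlgebra.norm_le_iff_le_algebraMap _ (norm_nonneg a) (sub_nonneg.2 h1)).2
      (sub_le_self _ ha)
  have h3 : f (algebraMap ℝ A ‖a‖ - a) = ‖a‖ - f a := by
    rw [map_sub, Algebra.algebraMap_eq_smul_one, ← Complex.coe_smul, map_smul, hf1,
      smul_eq_mul, mul_one]
  have h4 : (‖a‖ - f a : ℂ).re ≤ ‖a‖ := by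
    rw [← h3]
    exact (Complex.re_le_norm _).trans ((f.le_opNorm _).trans
      ((mul_le_of_le_one_left (norm_nonneg _) hf).trans h2))
  rw [Complex.sub_re, Complex.ofReal_re] at h4
  linarith

lemma one_add_norm_le_norm_one_add {A : Type*} [CStarAlgebra A] [PartialOrder A]
    [StarOrderedRing A] [Nontrivial A] {a : A} (ha : 0 ≤ a) : 1 + ‖a‖ ≤ ‖1 + a‖ := by
  have h0 : (0 : A) ≤ 1 + a := add_nonneg zero_le_one ha
  have h1 : 1 + a ≤ algebraMap ℝ A ‖1 + a‖ :=
    (CStarAlgebra.norm_le_iff_le_algebraMap _ (norm_nonneg _)).1 le_rfl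
  have h2 : 1 ≤ ‖1 + a‖ := by
    rw [← CStarRing.norm_one (E := A)]
    exact CStarAlgebra.norm_le_norm_of_nonneg_of_le zero_le_one (le_add_of_nonneg_right ha)
  have h3 : a ≤ algebraMap ℝ A (‖1 + a‖ - 1) := by
    rw [map_sub, map_one]
    exact le_sub_iff_add_le'.2 h1
  have := (CStarAlgebra.norm_le_iff_le_algebraMap a (sub_nonneg.2 h2)).2 h3
  linarith

variable {C : Type*} [NonUnitalCStarAlgebra C]

/-- A functional `f` norming `1 + x* x` in the unitization has `f(1)` and `f(x* x)` bounded by `1`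
and `‖x‖²`, while their real parts sum to at least `1 + ‖x‖²`. Both bounds are therefore attained,
and `f(1) = 1` forces positivity. -/
lemma exists_positive_functional_apply_star_mul_self (x : C) :
    ∃ ψ : StrongDual ℂ C, ‖ψ‖ ≤ 1 ∧ (∀ b, 0 ≤ ψ (star b * b)) ∧ ψ (star x * x) = (‖x‖ : ℂ) ^ 2 := by
  let _ := CStarAlgebra.spectralOrder (Unitization ℂ C)
  have _ := CStarAlgebra.spectralOrderedRing (Unitization ℂ C)
  have hp : ∀ b : C, (0 : Unitization ℂ C) ≤ ((star b * b : C) : Unitization ℂ C) := fun b => by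
    rw [Unitization.inr_mul, Unitization.inr_star]
    exact star_mul_self_nonneg _
  obtain ⟨f, hf, hfe⟩ := exists_dual_vector'' ℂ (1 + ((star x * x : C) : Unitization ℂ C))
  have hn := one_add_norm_le_norm_one_add (hp x)
  rw [Unitization.norm_inr, CStarRing.norm_star_mul_self] at hn
  have h1 : ‖f 1‖ ≤ 1 := (f.le_opNorm _).trans (by rw [CStarRing.norm_one, mul_one]; exact hf)
  have hpx : ‖f ((star x * x : C) : Unitization ℂ C)‖ ≤ ‖x‖ * ‖x‖ :=
    (f.le_opNorm _).trans ((mul_le_of_le_one_left (norm_nonneg _) hf).trans_eq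
      (by rw [Unitization.norm_inr, CStarRing.norm_star_mul_self]))
  have hre : (f 1).re + (f ((star x * x : C) : Unitization ℂ C)).re =
      ‖1 + ((star x * x : C) : Unitization ℂ C)‖ := by
    rw [← Complex.add_re, ← map_add, hfe]
    rfl
  have hr1 := Complex.re_le_norm (f 1)
  have hrx := Complex.re_le_norm (f ((star x * x : C) : Unitization ℂ C))
  have of_re : ∀ z : ℂ, ‖z‖ ≤ z.re → z = z.re := fun z hz => by
    have := Complex.re_eq_norm.1 (le_antisymm (Complex.re_le_norm z) hz)
    exact (Complex.eq_re_of_ofReal_le this)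
  have e1 : f 1 = 1 := by
    rw [of_re (f 1) (by linarith), show (f 1).re = 1 by linarith, Complex.ofReal_one]
  have ex : f ((star x * x : C) : Unitization ℂ C) = (‖x‖ : ℂ) ^ 2 := by
    rw [of_re (f _) (by linarith), show (f ((star x * x : C) : Unitization ℂ C)).re = ‖x‖ * ‖x‖ by
      linarith, Complex.ofReal_mul, sq]
  refine ⟨LinearMap.mkContinuous (f.toLinearMap ∘ₗ (Unitization.inrHom ℂ ℂ C)) 1 fun c => ?_,
    LinearMap.mkContinuous_norm_le _ zero_le_one _,
    fun b => apply_nonneg_of_norm_le_one hf e1 (hp b), ex⟩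
  refine (f.le_opNorm _).trans ?_
  rw [Unitization.inrHom_apply, Unitization.norm_inr]
  gcongr

/-- The functionals `φ` with `|φ(b)|² ≤ ψ(b* b)` for some positive contractive functional `ψ`. -/
def dominatedFunctionals (C : Type*) [NonUnitalCStarAlgebra C] : Set (WeakDual ℂ C) :=
  {φ | ∃ ψ : WeakDual ℂ C, ‖WeakDual.toStrongDual ψ‖ ≤ 1 ∧ (∀ b, 0 ≤ ψ (star b * b)) ∧
    ∀ b, ‖φ b‖ ^ 2 ≤ (ψ (star b * b)).re}

/-- Passing to pairs `(φ, ψ)` turns the existential over `ψ` into a projection of a closed subset of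
a product of two Banach-Alaoglu balls. -/
lemma isCompact_dominatedFunctionals : IsCompact (dominatedFunctionals C) := by
  let Q : Set (WeakDual ℂ C × WeakDual ℂ C) :=
    {p | (∀ b, 0 ≤ p.2 (star b * b)) ∧ ∀ b, ‖p.1 b‖ ^ 2 ≤ (p.2 (star b * b)).re}
  have hQ : IsClosed Q := by
    have e1 : ∀ b, Continuous fun p : WeakDual ℂ C × WeakDual ℂ C => p.1 b := fun b =>
      (WeakDual.eval_continuous b).comp continuous_fst
    have e2 : ∀ b, Continuous fun p : WeakDual ℂ C × WeakDual ℂ C => p.2 b := fun b =>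
      (WeakDual.eval_continuous b).comp continuous_snd
    have c1 : IsClosed {p : WeakDual ℂ C × WeakDual ℂ C | ∀ b, 0 ≤ p.2 (star b * b)} := by
      simp only [Set.ofPred_forall]
      exact isClosed_iInter fun b => isClosed_le continuous_const (e2 _)
    have c2 : IsClosed {p : WeakDual ℂ C × WeakDual ℂ C |
        ∀ b, ‖p.1 b‖ ^ 2 ≤ (p.2 (star b * b)).re} := by
      simp only [Set.ofPred_forall]
      exact isClosed_iInter fun b =>
        isClosed_le ((e1 b).norm.pow 2) (Complex.continuous_re.comp (e2 _))
    exact c1.inter c2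
  have hK := WeakDual.isCompact_closedBall (𝕜 := ℂ) (0 : StrongDual ℂ C) 1
  convert ((hK.prod hK).inter_right hQ).image continuous_fst
  ext φ
  constructor
  · rintro ⟨ψ, hψ, hψ0, hφ⟩
    refine ⟨(φ, ψ), ⟨⟨?_, by simpa using hψ⟩, hψ0, hφ⟩, rfl⟩
    rw [Set.mem_preimage, mem_closedBall_zero_iff]
    refine ContinuousLinearMap.opNorm_le_bound _ zero_le_one fun b => ?_
    rw [one_mul]
    refine le_of_sq_le_sq ?_ (norm_nonneg _)
    calc ‖φ b‖ ^ 2 ≤ (ψ (star b * b)).re := hφ b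
      _ ≤ ‖WeakDual.toStrongDual ψ (star b * b)‖ := Complex.re_le_norm _
      _ ≤ 1 * ‖star b * b‖ := ContinuousLinearMap.le_of_opNorm_le _ hψ _
      _ = ‖b‖ ^ 2 := by rw [one_mul, CStarRing.norm_star_mul_self, sq]
  · rintro ⟨⟨φ, ψ⟩, ⟨⟨-, hψ⟩, hψ0, hφ⟩, rfl⟩
    exact ⟨ψ, by simpa using hψ, hψ0, hφ⟩

lemma convex_dominatedFunctionals : Convex ℝ (dominatedFunctionals C) := by
  rintro φ ⟨ψ, hψ, hψ0, hφ⟩ φ' ⟨ψ', hψ', hψ0', hφ'⟩ s t hs ht hst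
  refine ⟨s • ψ + t • ψ', ?_, fun b => ?_, fun b => ?_⟩
  · rw [map_add]
    calc _ ≤ ‖s • WeakDual.toStrongDual ψ‖ + ‖t • WeakDual.toStrongDual ψ'‖ := norm_add_le _ _
      _ ≤ s * 1 + t * 1 := by
        rw [norm_smul, norm_smul, Real.norm_of_nonneg hs, Real.norm_of_nonneg ht]
        gcongr
      _ = 1 := by rw [mul_one, mul_one, hst]
  · change 0 ≤ s • ψ _ + t • ψ' _
    exact add_nonneg (smul_nonneg hs (hψ0 b)) (smul_nonneg ht (hψ0' b))
  · change ‖s • φ b + t • φ' b‖ ^ 2 ≤ (s • ψ (star b * b) + t • ψ' (star b * b)).re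
    have h1 : ‖s • φ b + t • φ' b‖ ≤ s * ‖φ b‖ + t * ‖φ' b‖ :=
      (norm_add_le _ _).trans_eq (by
        rw [norm_smul, norm_smul, Real.norm_of_nonneg hs, Real.norm_of_nonneg ht])
    have h2 : (s * ‖φ b‖ + t * ‖φ' b‖) ^ 2 ≤ s * ‖φ b‖ ^ 2 + t * ‖φ' b‖ ^ 2 :=
      (convexOn_pow 2).2 (norm_nonneg _) (norm_nonneg _) hs ht hst
    rw [Complex.add_re, Complex.smul_re, Complex.smul_re, smul_eq_mul, smul_eq_mul]
    calc _ ≤ (s * ‖φ b‖ + t * ‖φ' b‖) ^ 2 := by gcongr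
      _ ≤ _ := h2
      _ ≤ _ := by
        gcongr
        exacts [hφ b, hφ' b]

lemma norm_apply_star_mul_sq_le [PartialOrder C] [StarOrderedRing C] (f : C →ₚ[ℂ] ℂ) (a b : C) :
    ‖f (star a * b)‖ ^ 2 ≤ (f (star a * a)).re * (f (star b * b)).re := by
  have h := norm_inner_le_norm (𝕜 := ℂ) (f.toPreGNS a) (f.toPreGNS b)
  simp only [f.preGNS_inner_def, f.preGNS_norm_def, f.ofPreGNS_toPreGNS] at h
  have ha := (Complex.nonneg_iff.1 (f.map_nonneg (star_mul_self_nonneg a))).1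
  calc _ ≤ _ := pow_le_pow_left₀ (norm_nonneg _) h 2
    _ = _ := by
      rw [mul_pow, Real.sq_sqrt ha,
        Real.sq_sqrt (Complex.nonneg_iff.1 (f.map_nonneg (star_mul_self_nonneg b))).1]

/-- A bounded functional with nonnegative values on the elements `b* b`, as a positive map. -/
def toPositiveLinearMap [PartialOrder C] [StarOrderedRing C] (ψ : StrongDual ℂ C)
    (hψ : ∀ b, 0 ≤ ψ (star b * b)) : C →ₚ[ℂ] ℂ :=
  PositiveLinearMap.mk₀ ψ.toLinearMap fun a ha => by
    obtain ⟨b, rfl⟩ := CStarAlgebra.nonneg_iff_eq_star_mul_self.1 ha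
    exact hψ b

/-- With `ψ` norming `x* x`, the functional `‖x‖⁻¹ ψ(x* ·)` works, being dominated by `ψ` through
Cauchy-Schwarz. -/
lemma exists_dominatedFunctional_apply_eq_norm [PartialOrder C] [StarOrderedRing C] {x : C}
    (hx : x ≠ 0) : ∃ φ ∈ dominatedFunctionals C, φ x = (‖x‖ : ℂ) := by
  obtain ⟨ψ, hψ, hψ0, hψx⟩ := exists_positive_functional_apply_star_mul_self x
  have hn : 0 < ‖x‖ := norm_pos_iff.2 hx
  refine ⟨StrongDual.toWeakDual (LinearMap.mkContinuous
    ((‖x‖⁻¹ : ℂ) • (ψ.toLinearMap ∘ₗ LinearMap.mulLeft ℂ (star x))) 1 fun b => ?_),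
    ⟨StrongDual.toWeakDual ψ, hψ, hψ0, fun b => ?_⟩, ?_⟩
  · change ‖(‖x‖⁻¹ : ℂ) * ψ (star x * b)‖ ≤ 1 * ‖b‖
    rw [norm_mul, norm_inv, Complex.norm_real, norm_norm, one_mul, inv_mul_le_iff₀ hn]
    refine (ψ.le_of_opNorm_le hψ _).trans ?_
    rw [one_mul, ← norm_star x]
    exact norm_mul_le _ _
  · change ‖(‖x‖⁻¹ : ℂ) * ψ (star x * b)‖ ^ 2 ≤ (ψ (star b * b)).re
    have h : ‖ψ (star x * b)‖ ^ 2 ≤ (ψ (star x * x)).re * (ψ (star b * b)).re :=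
      norm_apply_star_mul_sq_le (toPositiveLinearMap ψ hψ0) x b
    rw [hψx, ← Complex.ofReal_pow, Complex.ofReal_re] at h
    rw [norm_mul, norm_inv, Complex.norm_real, norm_norm, mul_pow, inv_pow,
      inv_mul_le_iff₀ (by positivity)]
    exact h
  · change (‖x‖⁻¹ : ℂ) * ψ (star x * x) = ‖x‖
    rw [hψx, sq, inv_mul_cancel_left₀ (Complex.ofReal_ne_zero.2 hn.ne')]

/-- Every functional in the unit ball of the dual of a C*-algebra is dominated by a quasi-state. -/
theorem exists_dominating_functional [PartialOrder C] [StarOrderedRing C] (φ : StrongDual ℂ C)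
    (hφ : ‖φ‖ ≤ 1) : ∃ ψ : StrongDual ℂ C, ‖ψ‖ ≤ 1 ∧ (∀ b, 0 ≤ ψ (star b * b)) ∧
      ∀ b, ‖φ b‖ ^ 2 ≤ (ψ (star b * b)).re := by
  suffices h : StrongDual.toWeakDual φ ∈ dominatedFunctionals C from h
  by_contra hmem
  obtain ⟨x, u, hfu, huf⟩ := exists_re_apply_lt_of_notMem_weakDual convex_dominatedFunctionals
    isCompact_dominatedFunctionals.isClosed hmem
  simp only [RCLike.re_to_complex] at hfu huf
  rcases eq_or_ne x 0 with rfl | hx0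
  · have h0 := hfu 0 ⟨0, by simp, fun b => le_rfl, fun b => by
      change ‖(0 : ℂ)‖ ^ 2 ≤ (0 : ℂ).re
      simp⟩
    rw [map_zero] at h0 huf
    exact lt_asymm h0 huf
  · obtain ⟨χ, hχ, hχx⟩ := exists_dominatedFunctional_apply_eq_norm hx0
    have h1 := hfu χ hχ
    rw [hχx, Complex.ofReal_re] at h1
    have h2 : (φ x).re ≤ ‖x‖ := (Complex.re_le_norm _).trans
      ((φ.le_of_opNorm_le hφ x).trans_eq (one_mul _))
    exact absurd (h1.trans huf) (not_lt.2 h2)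

end Positivity

/-! ### Cyclic vectors in GNS spaces -/

section Cyclic

variable {C : Type*} [NonUnitalCStarAlgebra C] [PartialOrder C] [StarOrderedRing C]

/-- A functional on `C` that is bounded for the seminorm of a positive functional is an inner
product with a vector of the GNS space. -/
lemma exists_gns_inner_eq (f : C →ₚ[ℂ] ℂ) (φ : C →ₗ[ℂ] ℂ) {M : ℝ} (hM : 0 ≤ M)
    (h : ∀ b, ‖φ b‖ ≤ M * ‖f.toPreGNS b‖) :
    ∃ η : f.GNS, ‖η‖ ≤ M ∧ ∀ b, φ b = ⟪η, (f.toPreGNS b : f.GNS)⟫_ℂ := by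
  let g : StrongDual ℂ f.PreGNS := LinearMap.mkContinuous (φ ∘ₗ f.ofPreGNS.toLinearMap) M h
  let e : f.PreGNS →L[ℂ] f.GNS := UniformSpace.Completion.toComplL
  let G : StrongDual ℂ f.GNS := g.extend e
  have hG : ∀ b : f.PreGNS, G (b : f.GNS) = g b := fun b =>
    ContinuousLinearMap.extend_eq g UniformSpace.Completion.denseRange_coe
      (UniformSpace.Completion.isUniformInducing_coe _) b
  have hGn : ‖G‖ ≤ M := by
    refine ContinuousLinearMap.opNorm_le_bound _ hM fun z => ?_
    induction z using UniformSpace.Completion.induction_on with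
    | hp => exact isClosed_le (by fun_prop) (by fun_prop)
    | ih b =>
      rw [hG, UniformSpace.Completion.norm_coe]
      exact h (f.ofPreGNS b)
  refine ⟨(InnerProductSpace.toDual ℂ f.GNS).symm G, ?_, fun b => ?_⟩
  · rwa [LinearIsometryEquiv.norm_map]
  · rw [InnerProductSpace.toDual_symm_apply, hG]
    rfl

lemma norm_apply_le_of_norm_apply_mul_le {φ : StrongDual ℂ C} {r : C → ℝ}
    (h : ∀ u b, ‖u‖ ≤ 1 → ‖φ (u * b)‖ ≤ r b) (b : C) : ‖φ b‖ ≤ r b := by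
  have hl := CStarAlgebra.increasingApproximateUnit C
  have := hl.neBot
  have ht : Filter.Tendsto (fun u : C => ‖φ (u * b)‖) (CStarAlgebra.approximateUnit C)
      (nhds ‖φ b‖) := ((φ.continuous.tendsto b).comp (hl.tendsto_mul_right b)).norm
  exact le_of_tendsto ht (hl.eventually_norm.mono fun u hu => h u b hu)

/-- Cauchy-Schwarz against the unit, which is replaced here by a contractive approximate unit. -/
lemma norm_apply_le_of_norm_le_one (f : C →ₚ[ℂ] ℂ) (hf : ∀ a, ‖f a‖ ≤ ‖a‖) (b : C) :
    ‖f b‖ ≤ ‖f.toPreGNS b‖ := by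
  refine norm_apply_le_of_norm_apply_mul_le (φ := ⟨f.toLinearMap, map_continuous f⟩)
    (r := fun b => ‖f.toPreGNS b‖) (fun u b hu => ?_) b
  have h := norm_inner_le_norm (𝕜 := ℂ) (f.toPreGNS (star u)) (f.toPreGNS b)
  rw [f.preGNS_inner_def, f.ofPreGNS_toPreGNS, f.ofPreGNS_toPreGNS, star_star] at h
  have h1 : ‖f.toPreGNS (star u)‖ ≤ 1 := by
    rw [f.preGNS_norm_def, Real.sqrt_le_one]
    refine (Complex.re_le_norm _).trans ((hf _).trans ?_)
    rw [f.ofPreGNS_toPreGNS, CStarRing.norm_star_mul_self, norm_star]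
    exact mul_le_one₀ hu (norm_nonneg _) hu
  exact h.trans (mul_le_of_le_one_left (norm_nonneg _) h1)

/-- The GNS representation of a contractive positive functional has a cyclic vector. -/
lemma exists_gns_cyclic_vector (f : C →ₚ[ℂ] ℂ) (hf : ∀ a, ‖f a‖ ≤ ‖a‖) :
    ∃ ξ : f.GNS, ‖ξ‖ ≤ 1 ∧ ∀ a, f.gnsNonUnitalStarAlgHom a ξ = (f.toPreGNS a : f.GNS) := by
  -- There may be no unit whose class could serve as `ξ`, so `ξ` is the Riesz vector of `f` itself;
  -- then `⟪π(a)ξ, b⟫ = f(a* b) = ⟪a, b⟫`.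
  obtain ⟨ξ, hξ, h⟩ := exists_gns_inner_eq f f.toLinearMap zero_le_one fun b =>
    (norm_apply_le_of_norm_le_one f hf b).trans_eq (one_mul _).symm
  refine ⟨ξ, hξ, fun a => ext_inner_right ℂ fun z => ?_⟩
  induction z using UniformSpace.Completion.induction_on with
  | hp => exact isClosed_eq (by fun_prop) (by fun_prop)
  | ih b =>
    rw [← ContinuousLinearMap.adjoint_inner_right, ← ContinuousLinearMap.star_eq_adjoint,
      ← map_star, f.gnsNonUnitalStarAlgHom_apply_coe, UniformSpace.Completion.inner_coe,
      f.preGNS_inner_def]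
    exact (h (star a * f.ofPreGNS b)).symm

end Cyclic

/-! ### Matrix coefficients of a direct sum -/

section DirectSum

variable {C : Type*} [NonUnitalCStarAlgebra C] {ι : Type*} [DecidableEq ι] {H : ι → Type*}
  [∀ i, NormedAddCommGroup (H i)] [∀ i, InnerProductSpace ℂ (H i)] [∀ i, CompleteSpace (H i)]

lemma inner_single_directSumRep_single (π : ∀ i, C →⋆ₙₐ[ℂ] (H i →L[ℂ] H i)) (a : C) (i : ι)
    (x y : H i) :
    ⟪lp.single 2 i y, directSumRep π a (lp.single 2 i x)⟫_ℂ = ⟪y, π i a x⟫_ℂ := by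
  rw [lp.inner_single_left]
  change ⟪y, directSumOp π a (lp.single 2 i x) i⟫_ℂ = _
  rw [directSumOp_apply, lp.single_apply_self]

end DirectSum

/-! ### Functionals as vector functionals of the universal representation -/

section Universal

universe u

variable {C : Type u} [NonUnitalCStarAlgebra C] [PartialOrder C] [StarOrderedRing C]

/-- Normalisation of a contractive positive functional dominating a nonzero functional. -/
lemma exists_state_dominating {φ : StrongDual ℂ C} (hφ : ‖φ‖ ≤ 1) (h0 : φ ≠ 0) :
    ∃ s : StateSpace C, ∀ b, ‖φ b‖ ^ 2 ≤ (s.1 (star b * b)).re := by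
  obtain ⟨ψ, hψ, hψ0, h⟩ := exists_dominating_functional φ hφ
  have hne : ψ ≠ 0 := by
    rintro rfl
    refine h0 (ContinuousLinearMap.ext fun b => ?_)
    have := h b
    rw [zero_apply, Complex.zero_re] at this
    rw [zero_apply, ← norm_eq_zero]
    exact pow_eq_zero_iff two_ne_zero |>.1 (le_antisymm this (sq_nonneg _))
  have hn : 0 < ‖ψ‖ := norm_pos_iff.2 hne
  have hc : (0 : ℂ) ≤ ((‖ψ‖⁻¹ : ℝ) : ℂ) := Complex.zero_le_real.2 (inv_nonneg.2 hn.le)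
  refine ⟨⟨toPositiveLinearMap (((‖ψ‖⁻¹ : ℝ) : ℂ) • ψ) fun b => mul_nonneg hc (hψ0 b), ?_⟩,
    fun b => ?_⟩
  · change ‖((‖ψ‖⁻¹ : ℝ) : ℂ) • ψ‖ = 1
    rw [norm_smul, Complex.norm_real, norm_inv, norm_norm, inv_mul_cancel₀ hn.ne']
  · change _ ≤ (((‖ψ‖⁻¹ : ℝ) : ℂ) * ψ (star b * b)).re
    -- As `‖ψ‖ ≤ 1`, normalising only enlarges the dominating values.
    rw [Complex.re_ofReal_mul]
    exact (h b).trans (le_mul_of_one_le_left (Complex.nonneg_iff.1 (hψ0 b)).1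
      ((one_le_inv₀ hn).2 hψ))

lemma StateSpace.norm_apply_le (s : StateSpace C) (a : C) : ‖s.1 a‖ ≤ ‖a‖ := by
  have := (⟨s.1.toLinearMap, map_continuous s.1⟩ : StrongDual ℂ C).le_opNorm a
  rwa [s.2, one_mul] at this

lemma exists_universalRep_inner_of_norm_le_one {φ : StrongDual ℂ C} (hφ : ‖φ‖ ≤ 1) :
    ∃ ξ η : UniversalSpace C, ‖ξ‖ ≤ 1 ∧ ‖η‖ ≤ 1 ∧ ∀ a, φ a = ⟪η, universalRep C a ξ⟫_ℂ := by
  classical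
  -- The zero functional is separate because `C = 0` has no states.
  rcases eq_or_ne φ 0 with rfl | h0
  · exact ⟨0, 0, by simp, by simp, fun a => by simp⟩
  obtain ⟨s, hs⟩ := exists_state_dominating hφ h0
  obtain ⟨ξ, hξ, hcyc⟩ := exists_gns_cyclic_vector s.1 s.norm_apply_le
  obtain ⟨η, hη, hin⟩ := exists_gns_inner_eq s.1 φ.toLinearMap zero_le_one fun b => by
    rw [one_mul, s.1.preGNS_norm_def]
    exact Real.le_sqrt_of_sq_le (hs b)
  refine ⟨lp.single 2 s ξ, lp.single 2 s η, ?_, ?_, fun a => ?_⟩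
  · exact (lp.norm_single (E := fun s : StateSpace C => s.1.GNS) two_pos s ξ).trans_le hξ
  · exact (lp.norm_single (E := fun s : StateSpace C => s.1.GNS) two_pos s η).trans_le hη
  · rw [universalRep, inner_single_directSumRep_single, hcyc]
    exact hin a

/-- Every bounded functional on `C` is a vector functional of the universal representation, with
control of the norms. -/
theorem exists_universalRep_inner (φ : StrongDual ℂ C) :
    ∃ ξ η : UniversalSpace C, ‖ξ‖ ≤ 1 ∧ ‖η‖ ≤ ‖φ‖ ∧ ∀ a, φ a = ⟪η, universalRep C a ξ⟫_ℂ := by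
  rcases eq_or_ne φ 0 with rfl | h0
  · exact ⟨0, 0, by simp, by simp, fun a => by simp⟩
  have hn : ‖φ‖ ≠ 0 := norm_ne_zero_iff.2 h0
  obtain ⟨ξ, η, hξ, hη, h⟩ := exists_universalRep_inner_of_norm_le_one
    (φ := ((‖φ‖⁻¹ : ℝ) : ℂ) • φ)
    (by rw [norm_smul, Complex.norm_real, norm_inv, norm_norm, inv_mul_cancel₀ hn])
  refine ⟨ξ, (‖φ‖ : ℂ) • η, hξ, ?_, fun a => ?_⟩
  · rw [norm_smul, Complex.norm_real, norm_norm]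
    exact mul_le_of_le_one_right (norm_nonneg _) hη
  · rw [inner_smul_left, ← h a, Complex.conj_ofReal, smul_apply, smul_eq_mul,
      Complex.ofReal_inv, mul_inv_cancel_left₀ (Complex.ofReal_ne_zero.2 hn)]

end Universal

/-! ### Extension of a representation to the bidual -/

section NormalExtension

universe u

variable {C : Type u} [NonUnitalCStarAlgebra C] {H : Type*} [NormedAddCommGroup H]
  [InnerProductSpace ℂ H] [CompleteSpace H] (π : C →⋆ₙₐ[ℂ] (H →L[ℂ] H))

/-- The vector functional `a ↦ ⟪η, π(a) ξ⟫`. -/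
noncomputable def vectorFunctional (η ξ : H) : StrongDual ℂ C :=
  LinearMap.mkContinuous
    { toFun := fun a => ⟪η, π a ξ⟫_ℂ
      map_add' := fun a b => by rw [map_add, add_apply, inner_add_right]
      map_smul' := fun c a => by rw [map_smul, smul_apply, inner_smul_right]; rfl }
    (‖η‖ * ‖ξ‖) fun a => by
      refine (norm_inner_le_norm _ _).trans ?_
      rw [mul_assoc, mul_comm ‖ξ‖]
      gcongr
      exact (π a).le_of_opNorm_le (NonUnitalStarAlgHom.norm_apply_le π a) ξ

lemma vectorFunctional_apply (η ξ : H) (a : C) : vectorFunctional π η ξ a = ⟪η, π a ξ⟫_ℂ := rfl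

lemma norm_vectorFunctional_le (η ξ : H) : ‖vectorFunctional π η ξ‖ ≤ ‖η‖ * ‖ξ‖ :=
  LinearMap.mkContinuous_norm_le _ (by positivity) _

lemma exists_inner_eq_apply_vectorFunctional (F : Bidual C) :
    ∃ T : H →L[ℂ] H, ∀ η ξ, ⟪η, T ξ⟫_ℂ = F (vectorFunctional π η ξ) := by
  let B : H →L⋆[ℂ] H →L[ℂ] ℂ := LinearMap.mkContinuous₂
    (LinearMap.mk₂'ₛₗ (starRingEnd ℂ) (RingHom.id ℂ) (fun η ξ => F (vectorFunctional π η ξ))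
      (fun η η' ξ => by
        rw [← map_add]
        congr 1
        ext a
        exact inner_add_left _ _ _)
      (fun c η ξ => by
        rw [← map_smul]
        congr 1
        ext a
        exact inner_smul_left _ _ _)
      (fun η ξ ξ' => by
        rw [← map_add]
        congr 1
        ext a
        simp only [add_apply, vectorFunctional_apply, map_add, inner_add_right])
      (fun c η ξ => by
        rw [← map_smul]
        congr 1
        ext a
        simp only [smul_apply, vectorFunctional_apply, map_smul, inner_smul_right, smul_eq_mul,
          RingHom.id_apply])) ‖F‖ fun η ξ => by
      rw [mul_assoc]
      exact (F.le_opNorm _).trans (by gcongr; exact norm_vectorFunctional_le π η ξ)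
  refine ⟨ContinuousLinearMap.adjoint (InnerProductSpace.continuousLinearMapOfBilin B),
    fun η ξ => ?_⟩
  rw [ContinuousLinearMap.adjoint_inner_right,
    InnerProductSpace.continuousLinearMapOfBilin_apply]
  rfl

/-- The extension of a representation of `C` to the bidual of `C`. -/
noncomputable def bidualRep (F : Bidual C) : H →L[ℂ] H :=
  (exists_inner_eq_apply_vectorFunctional π F).choose

lemma inner_bidualRep (F : Bidual C) (η ξ : H) :
    ⟪η, bidualRep π F ξ⟫_ℂ = F (vectorFunctional π η ξ) :=
  (exists_inner_eq_apply_vectorFunctional π F).choose_spec η ξ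

lemma norm_bidualRep_le (F : Bidual C) : ‖bidualRep π F‖ ≤ ‖F‖ := by
  refine ContinuousLinearMap.opNorm_le_of_re_inner_le (𝕜 := ℂ) (norm_nonneg F)
    fun ξ η hξ hη => ?_
  rw [inner_re_symm, inner_bidualRep]
  refine (Complex.re_le_norm _).trans ((F.le_opNorm _).trans
    (mul_le_of_le_one_right (norm_nonneg F) ((norm_vectorFunctional_le π η ξ).trans ?_)))
  rw [hξ, hη, one_mul]

/-- The extension of a representation of `C` to the bidual of `C`, as an additive map. -/
noncomputable def bidualRepHom : Bidual C →+ (H →L[ℂ] H) :=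
  AddMonoidHom.mk' (bidualRep π) fun F G => by
    ext ξ
    refine ext_inner_left ℂ fun η => ?_
    rw [add_apply, inner_add_right, inner_bidualRep, inner_bidualRep, inner_bidualRep]
    rfl

/-- Specialising `c` and the vectors yields additivity, homogeneity, vanishing on annihilators and
independence of the representing vectors. -/
lemma inner_eq_add_smul_of_mem_wotClosure {S : Set C} {T : H →L[ℂ] H}
    (hT : T ∈ wotClosure (π '' S)) {η η₁ η₂ ξ ξ₁ ξ₂ : H} {c : ℂ}
    (h : ∀ a ∈ S, ⟪η, π a ξ⟫_ℂ = ⟪η₁, π a ξ₁⟫_ℂ + c * ⟪η₂, π a ξ₂⟫_ℂ) :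
    ⟪η, T ξ⟫_ℂ = ⟪η₁, T ξ₁⟫_ℂ + c * ⟪η₂, T ξ₂⟫_ℂ := by
  have hc : ∀ η ξ : H, Continuous fun R : H →WOT[ℂ] H => ⟪η, R ξ⟫_ℂ := fun η ξ =>
    ContinuousLinearMapWOT.continuous_dual_apply ξ (innerSL ℂ η)
  have hcl : IsClosed {R : H →WOT[ℂ] H |
      ⟪η, R ξ⟫_ℂ = ⟪η₁, R ξ₁⟫_ℂ + c * ⟪η₂, R ξ₂⟫_ℂ} :=
    isClosed_eq (hc _ _) ((hc _ _).add (continuous_const.mul (hc _ _)))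
  refine closure_minimal ?_ hcl hT
  rintro _ ⟨_, ⟨a, ha, rfl⟩, rfl⟩
  exact h a ha

/-- Each functional on `C` is a vector functional of `π`, with control of the norms. -/
def RepresentsDual : Prop :=
  ∀ φ : StrongDual ℂ C, ∃ ξ η : H, ‖ξ‖ ≤ 1 ∧ ‖η‖ ≤ ‖φ‖ ∧ ∀ a, φ a = ⟪η, π a ξ⟫_ℂ

variable {π}

lemma RepresentsDual.norm_bidualRep (hπ : RepresentsDual π) (F : Bidual C) :
    ‖bidualRep π F‖ = ‖F‖ := by
  refine le_antisymm (norm_bidualRep_le π F) ?_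
  refine ContinuousLinearMap.opNorm_le_bound _ (norm_nonneg _) fun φ => ?_
  obtain ⟨ξ, η, hξ, hη, h⟩ := hπ φ
  have hφ : φ = vectorFunctional π η ξ := ContinuousLinearMap.ext h
  calc ‖F φ‖ = ‖⟪η, bidualRep π F ξ⟫_ℂ‖ := by rw [inner_bidualRep, ← hφ]
    _ ≤ ‖η‖ * ‖bidualRep π F ξ‖ := norm_inner_le_norm _ _
    _ ≤ ‖φ‖ * (‖bidualRep π F‖ * 1) := by
      gcongr
      exact (bidualRep π F).le_opNorm_of_le hξ
    _ = ‖bidualRep π F‖ * ‖φ‖ := by rw [mul_one, mul_comm]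

/-- The preimage is `F(φ) = ⟪η_φ, T ξ_φ⟫` for arbitrarily chosen representing vectors; relations
among vector functionals on `A` persist for `T`. -/
lemma RepresentsDual.exists_bidualRep_eq (hπ : RepresentsDual π)
    {A : NonUnitalStarSubalgebra ℂ C} {T : H →L[ℂ] H}
    (hT : T ∈ wotClosure (π '' (A : Set C))) : ∃ F ∈ bidualOf A, bidualRep π F = T := by
  choose ξ η hξ hη h using hπ
  refine ⟨LinearMap.mkContinuous
    { toFun := fun φ => ⟪η φ, T (ξ φ)⟫_ℂ
      map_add' := fun φ χ => ?_
      map_smul' := fun c φ => ?_ } ‖T‖ fun φ => ?_, (mem_bidualOf_iff A _).2 fun φ hφ => ?_, ?_⟩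
  · rw [inner_eq_add_smul_of_mem_wotClosure π hT (η₁ := η φ) (ξ₁ := ξ φ) (η₂ := η χ)
      (ξ₂ := ξ χ) (c := 1) fun a _ => by rw [← h, ← h, ← h, one_mul]; rfl, one_mul]
  · rw [inner_eq_add_smul_of_mem_wotClosure π hT (η₁ := 0) (ξ₁ := 0) (η₂ := η φ)
      (ξ₂ := ξ φ) (c := c) fun a _ => by rw [← h, ← h, inner_zero_left, zero_add]; rfl,
      inner_zero_left, zero_add]
    rfl
  · calc ‖⟪η φ, T (ξ φ)⟫_ℂ‖ ≤ ‖η φ‖ * ‖T (ξ φ)‖ := norm_inner_le_norm _ _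
      _ ≤ ‖φ‖ * (‖T‖ * 1) := by
        gcongr
        exacts [hη φ, T.le_opNorm_of_le (hξ φ)]
      _ = ‖T‖ * ‖φ‖ := by rw [mul_one, mul_comm]
  · change ⟪η φ, T (ξ φ)⟫_ℂ = 0
    rw [inner_eq_add_smul_of_mem_wotClosure π hT (η₁ := 0) (ξ₁ := 0) (η₂ := 0)
      (ξ₂ := 0) (c := 0) fun a ha => ?_, inner_zero_left, zero_mul, zero_add]
    rw [← h, inner_zero_left, zero_mul, zero_add]
    exact DFunLike.congr_fun hφ (⟨a, ha⟩ : A.toSubmodule)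
  · ext x
    refine ext_inner_left ℂ fun y => ?_
    rw [inner_bidualRep]
    change ⟪η (vectorFunctional π y x), T (ξ (vectorFunctional π y x))⟫_ℂ = ⟪y, T x⟫_ℂ
    rw [inner_eq_add_smul_of_mem_wotClosure π hT (η₁ := y) (ξ₁ := x) (η₂ := 0)
      (ξ₂ := 0) (c := 0) fun a _ => ?_, zero_mul, add_zero]
    rw [← h, zero_mul, add_zero, vectorFunctional_apply]

variable (π)

/-- A weakly continuous functional on `B(H)` is, on `π(C)`, a bounded functional, and is compatible
with the extension of `π` to the bidual. -/
lemma exists_functional_comp_bidualRep (f : StrongDual ℂ (H →WOT[ℂ] H)) :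
    ∃ φ : StrongDual ℂ C, (∀ a, f (.ofCLM (π a)) = φ a) ∧
      ∀ F, f (.ofCLM (bidualRep π F)) = F φ := by
  let g : H × StrongDual ℂ H → (H →WOT[ℂ] H) →ₗ[ℂ] ℂ := fun p =>
    LinearMap.proj p ∘ₗ ContinuousLinearMapWOT.inducingFn (RingHom.id ℂ) H H
  -- The weak operator topology is the coarsest making all `R ↦ y (R x)` continuous, so its
  -- continuous functionals are their finite combinations.
  have hspan : f.toLinearMap ∈ Submodule.span ℂ (Set.range g) := by
    rw [LinearMap.mem_span_iff_continuous]
    have htop : (ContinuousLinearMapWOT.instTopologicalSpace : TopologicalSpace (H →WOT[ℂ] H)) =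
        ⨅ p, .induced (g p) inferInstance := by
      unfold ContinuousLinearMapWOT.instTopologicalSpace Pi.topologicalSpace
      simp only [induced_iInf, induced_compose]
      rfl
    rw [← htop]
    exact f.continuous
  have key : ∀ l ∈ Submodule.span ℂ (Set.range g), ∃ φ : StrongDual ℂ C,
      (∀ a, l (.ofCLM (π a)) = φ a) ∧ ∀ F, l (.ofCLM (bidualRep π F)) = F φ := by
    intro l hl
    induction hl using Submodule.span_induction with
    | mem l hl =>
      obtain ⟨⟨x, y⟩, rfl⟩ := hl
      have hy : ∀ z, y z = ⟪(InnerProductSpace.toDual ℂ H).symm y, z⟫_ℂ := fun z =>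
        InnerProductSpace.toDual_symm_apply.symm
      refine ⟨vectorFunctional π ((InnerProductSpace.toDual ℂ H).symm y) x, fun a => hy _,
        fun F => ?_⟩
      rw [← inner_bidualRep]
      exact hy _
    | zero => exact ⟨0, fun _ => rfl, fun F => (map_zero F).symm⟩
    | add l m _ _ hl hm =>
      obtain ⟨φ, h1, h2⟩ := hl
      obtain ⟨χ, h3, h4⟩ := hm
      exact ⟨φ + χ, fun a => by rw [LinearMap.add_apply, h1, h3]; rfl,
        fun F => by rw [LinearMap.add_apply, h2, h4, map_add]⟩
    | smul c l _ hl =>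
      obtain ⟨φ, h1, h2⟩ := hl
      exact ⟨c • φ, fun a => by rw [LinearMap.smul_apply, h1]; rfl,
        fun F => by rw [LinearMap.smul_apply, h2, map_smul]⟩
  exact key _ hspan

/-- A separating functional would restrict to some `φ` on `C` with real part bounded above on the
subspace `A`. It then vanishes on `A`, so `F φ = 0` and nothing is separated. -/
lemma bidualRep_mem_wotClosure {A : NonUnitalStarSubalgebra ℂ C} {F : Bidual C}
    (hF : F ∈ bidualOf A) : bidualRep π F ∈ wotClosure (π '' (A : Set C)) := by
  by_contra hmem
  let V : Submodule ℂ (H →WOT[ℂ] H) := A.toSubmodule.map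
    ((ContinuousLinearMapWOT.linearEquiv ℂ).symm.toLinearMap ∘ₗ
      (π : C →ₗ[ℂ] (H →L[ℂ] H)))
  have hV : (fun R : H →L[ℂ] H => ContinuousLinearMapWOT.ofCLM R) '' (π '' (A : Set C)) =
      (V : Set (H →WOT[ℂ] H)) := Set.image_image _ _ _
  have hconv : Convex ℝ (closure (V : Set (H →WOT[ℂ] H))) :=
    (V.restrictScalars ℝ).convex.closure
  have hmem' : ContinuousLinearMapWOT.ofCLM (bidualRep π F) ∉
      closure (V : Set (H →WOT[ℂ] H)) := by
    rw [← hV]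
    exact hmem
  obtain ⟨f, u, hfu, huf⟩ := RCLike.geometric_hahn_banach_closed_point (𝕜 := ℂ) hconv
    isClosed_closure hmem'
  obtain ⟨φ, hφ, hφF⟩ := exists_functional_comp_bidualRep π f
  have hmul : ∀ a ∈ A, (φ a).re < u := fun a ha => by
    rw [← hφ]
    exact hfu _ (subset_closure (hV ▸ ⟨_, ⟨a, ha, rfl⟩, rfl⟩))
  have hzero : restrictDual A φ = 0 := by
    ext ⟨a, ha⟩
    by_contra h0
    have h1 : φ a ≠ 0 := h0
    -- The scaling makes `φ` take exactly the forbidden value `u`.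
    have h2 := hmul _ (A.toSubmodule.smul_mem ((u : ℂ) * (φ a)⁻¹) ha)
    rw [map_smul, smul_eq_mul, inv_mul_cancel_right₀ h1, Complex.ofReal_re] at h2
    exact lt_irrefl _ h2
  have h0 : 0 < u := by simpa using hmul 0 A.zero_mem
  rw [hφF, (mem_bidualOf_iff A F).1 hF φ hzero] at huf
  exact lt_asymm h0 (by simpa using huf)

variable {π}

lemma RepresentsDual.image_bidualOf (hπ : RepresentsDual π) (A : NonUnitalStarSubalgebra ℂ C) :
    bidualRepHom π '' bidualOf A = wotClosure (π '' (A : Set C)) := by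
  ext T
  constructor
  · rintro ⟨F, hF, rfl⟩
    exact bidualRep_mem_wotClosure π hF
  · exact fun hT => hπ.exists_bidualRep_eq hT

end NormalExtension

-- Transfer to the enveloping von Neumann algebra

universe u

variable {C : Type u} [NonUnitalCStarAlgebra C] [PartialOrder C] [StarOrderedRing C]

lemma image_coe_envelopingOf (A : NonUnitalStarSubalgebra ℂ C) :
    (Subtype.val : envelopingVNA C → _) '' envelopingOf A =
      wotClosure (universalRep C '' (A : Set C)) :=
  Set.Subset.antisymm (by rintro _ ⟨T, hT, rfl⟩; exact hT)
    fun T hT => ⟨⟨T, wotClosure_subset_envelopingVNA A hT⟩, hT, rfl⟩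

theorem christensenDist_bidualOf_eq_envelopingOf (A B : NonUnitalStarSubalgebra ℂ C) :
    christensenDist (bidualOf A) (bidualOf B) =
      christensenDist (envelopingOf A) (envelopingOf B) := by
  have hπ : RepresentsDual (universalRep C) := exists_universalRep_inner
  rw [← christensenDist_image (bidualRepHom (universalRep C)) hπ.norm_bidualRep,
    hπ.image_bidualOf, hπ.image_bidualOf, ← image_coe_envelopingOf, ← image_coe_envelopingOf]
  exact christensenDist_image (AddSubmonoidClass.subtype (envelopingVNA C)) (fun _ => rfl) _ _

end EnvelopingDistance

open EnvelopingDistance in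
theorem theorem3p1 {C : Type*} [NonUnitalCStarAlgebra C] [PartialOrder C] [StarOrderedRing C]
    (A B : NonUnitalStarSubalgebra ℂ C)
    (hA : IsClosed (A : Set C)) (hB : IsClosed (B : Set C)) :
    christensenDist (A : Set C) (B : Set C) = christensenDist (bidualOf A) (bidualOf B) ∧
    christensenDist (A : Set C) (B : Set C) =
      christensenDist (envelopingOf A) (envelopingOf B) :=
  ⟨christensenDist_bidualOf A B,
    (christensenDist_bidualOf A B).trans (christensenDist_bidualOf_eq_envelopingOf A B)⟩
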